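/- Let $d\in\mathbb N$, let $\Omega,\Sigma\subset\mathbb R^d$ be bounded open sets (for instance bounded Lipschitz domains), and let $\Omega_\Sigma:=\{x\in\mathbb R^d : \text{there is } y\in\Sigma \text{ with } x-y\in\Omega\}$. Let $1<q\le 2$, $s\in[q,\infty)$ and $s'=s/(s-1)$. All spaces are real. Denote by $C_0(\Omega_\Sigma)$ the continuous functions on $\Omega_\Sigma$ that vanish at infinity, with the supremum norm, and by $\mathcal M(\Omega_\Sigma)=C_0(\Omega_\Sigma)^*$ the space of Radon measures. For normed spaces $X,Y$ let $X\otimes_\pi Y$ and $X\otimes_{\mathfrak i}Y$ be the completions of the algebraic tensor product $X\otimes Y$ with respect to the projective norm $\|u\|_\pi=\inf\{\sum_{i=1}^n\|x_i\|\|y_i\| : u=\sum_{i=1}^n x_i\otimes y_i\}$ and the injective norm $\|u\|_{\mathfrak i}=\sup\{|\sum_{i=1}^n\varphi(x_i)\psi(y_i)| : \|\varphi\|_{X^*}\le1,\ \|\psi\|_{Y^*}\le 1\}$ for $u=\sum_{i=1}^n x_i\otimes y_i$. Let $Z$ be a reflexive Banach space, let $M:L^s(\Sigma)\to Z$ be bounded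 and linear, and let $$\hat M:=I\otimes_\pi M:\ \mathcal M(\Omega_\Sigma)\otimes_\pi L^s(\Sigma)\to\mathcal M(\Omega_\Sigma)\otimes_\pi Z$$ be the bounded linear operator with $\hat M(c\otimes p)=c\otimes Mp$. Equip $\mathcal M(\Omega_\Sigma)\otimes_\pi L^s(\Sigma)$ with the weak* topology induced by the predual $C_0(\Omega_\Sigma)\otimes_{\mathfrak i}L^{s'}(\Sigma)$, and $\mathcal M(\Omega_\Sigma)\otimes_\pi Z$ with the weak* topology induced by the predual $C_0(\Omega_\Sigma)\otimes_{\mathfrak i}Z^*$, where the bounded bilinear duality pairings are determined by $\langle c\otimes p,\phi\otimes g\rangle=c(\phi)\int_\Sigma p\,g\,dx$ and $\langle c\otimes z,\phi\otimes\psi\rangle=c(\phi)\,\psi(z)$, respectively; that is, each weak* topology is the coarsest one for which the pairing with every element of the predual is continuous. Then $\hat M$ is continuous with respect to these two weak* topologies. In particular, $u_n\to u$ weakly* implies $\hat Mu_n\to\hat Mu$ weakly*. -/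

import Mathlib

open MeasureTheory
open scoped TensorProduct ENNReal Topology

set_option maxSynthPendingDepth 3

noncomputable section

/-! ## The projective tensor product of two normed spaces -/

section Projective

/-- The algebraic tensor product `X ⊗ Y`, as a type synonym that carries the projective norm. -/
def ProjAlg (X Y : Type*) [NormedAddCommGroup X] [NormedSpace ℝ X]
    [NormedAddCommGroup Y] [NormedSpace ℝ Y] : Type _ := X ⊗[ℝ] Y

variable (X Y : Type*) [NormedAddCommGroup X] [NormedSpace ℝ X]
  [NormedAddCommGroup Y] [NormedSpace ℝ Y]

instance : AddCommGroup (ProjAlg X Y) := inferInstanceAs (AddCommGroup (X ⊗[ℝ] Y))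
instance : Module ℝ (ProjAlg X Y) := inferInstanceAs (Module ℝ (X ⊗[ℝ] Y))

variable {X Y}

/-- The elementary tensor `x ⊗ y`. -/
def ProjAlg.tmul (x : X) (y : Y) : ProjAlg X Y := x ⊗ₜ[ℝ] y

/-- The costs `∑ ‖xᵢ‖ ‖yᵢ‖` of all finite representations `u = ∑ xᵢ ⊗ yᵢ`. -/
def ProjAlg.costs (u : ProjAlg X Y) : Set ℝ :=
  {r | ∃ l : List (X × Y), u = (l.map fun p => ProjAlg.tmul p.1 p.2).sum ∧
    r = (l.map fun p => ‖p.1‖ * ‖p.2‖).sum}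

theorem ProjAlg.costs_nonempty (u : ProjAlg X Y) : u.costs.Nonempty := by
  refine TensorProduct.induction_on (motive := fun u : X ⊗[ℝ] Y =>
    (ProjAlg.costs (X := X) (Y := Y) u).Nonempty) u ?_ ?_ ?_
  · exact ⟨0, [], rfl, rfl⟩
  · intro x y
    exact ⟨‖x‖ * ‖y‖, [(x, y)], (List.sum_singleton (α := ProjAlg X Y)).symm, by simp⟩
  · rintro a b ⟨r, l, h1, h2⟩ ⟨r', l', h1', h2'⟩
    refine ⟨r + r', l ++ l', ?_, ?_⟩
    · rw [List.map_append, List.sum_append, ← h1, ← h1']; rfl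
    · rw [List.map_append, List.sum_append, ← h2, ← h2']

theorem ProjAlg.costs_nonneg {u : ProjAlg X Y} {r : ℝ} (hr : r ∈ u.costs) : 0 ≤ r := by
  obtain ⟨l, -, rfl⟩ := hr
  refine List.sum_nonneg fun a ha => ?_
  obtain ⟨p, -, rfl⟩ := List.mem_map.1 ha
  positivity

theorem ProjAlg.costs_bddBelow (u : ProjAlg X Y) : BddBelow u.costs :=
  ⟨0, fun _ hr => ProjAlg.costs_nonneg hr⟩

/-- The projective norm `‖u‖_π = inf {∑ ‖xᵢ‖ ‖yᵢ‖ | u = ∑ xᵢ ⊗ yᵢ}`. -/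
def ProjAlg.projSeminorm (X Y : Type*) [NormedAddCommGroup X] [NormedSpace ℝ X]
    [NormedAddCommGroup Y] [NormedSpace ℝ Y] : Seminorm ℝ (ProjAlg X Y) :=
  Seminorm.ofSMulLE (fun u => sInf u.costs)
    (le_antisymm (csInf_le (ProjAlg.costs_bddBelow 0) ⟨[], rfl, rfl⟩)
      (le_csInf (ProjAlg.costs_nonempty 0) fun _ hr => ProjAlg.costs_nonneg hr))
    (fun u v => by
      refine le_of_forall_pos_le_add fun ε hε => ?_
      obtain ⟨r, hr, hr'⟩ := Real.lt_sInf_add_pos u.costs_nonempty (half_pos hε)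
      obtain ⟨t, ht, ht'⟩ := Real.lt_sInf_add_pos v.costs_nonempty (half_pos hε)
      obtain ⟨l, h1, h2⟩ := hr
      obtain ⟨l', h1', h2'⟩ := ht
      have : sInf (u + v).costs ≤ r + t := csInf_le (ProjAlg.costs_bddBelow _)
        ⟨l ++ l', by rw [List.map_append, List.sum_append, ← h1, ← h1'],
          by rw [List.map_append, List.sum_append, ← h2, ← h2']⟩
      linarith)
    (fun c u => by
      refine le_of_forall_pos_le_add fun ε hε => ?_
      have hpos : 0 < ‖c‖ + 1 := by positivity
      obtain ⟨r, hr, hr'⟩ := Real.lt_sInf_add_pos u.costs_nonempty (div_pos hε hpos)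
      obtain ⟨l, h1, h2⟩ := hr
      have hle : sInf (c • u).costs ≤ ‖c‖ * r := by
        refine csInf_le (ProjAlg.costs_bddBelow _) ⟨l.map fun p => (c • p.1, p.2), ?_, ?_⟩
        · rw [h1, List.smul_sum, List.map_map, List.map_map]
          rfl
        · rw [h2, List.map_map, ← List.sum_map_mul_left]
          simp [Function.comp_def, norm_smul, mul_assoc]
      have h3 : ‖c‖ * r ≤ ‖c‖ * (sInf u.costs + ε / (‖c‖ + 1)) := by gcongr
      have h4 : ‖c‖ * (ε / (‖c‖ + 1)) ≤ ε := by
        rw [← mul_div_assoc, div_le_iff₀ hpos]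
        nlinarith [norm_nonneg c]
      linarith)

variable (X Y)

instance : SeminormedAddCommGroup (ProjAlg X Y) :=
  (ProjAlg.projSeminorm X Y).toAddGroupSeminorm.toSeminormedAddCommGroup

instance : NormedSpace ℝ (ProjAlg X Y) where
  norm_smul_le c u := (map_smul_eq_mul (ProjAlg.projSeminorm X Y) c u).le

theorem ProjAlg.norm_def (u : ProjAlg X Y) : ‖u‖ = sInf u.costs := rfl

/-- The projective tensor product `X ⊗_π Y`: the completion of `X ⊗ Y` in the projective norm. -/
abbrev ProjTensor : Type _ := UniformSpace.Completion (ProjAlg X Y)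

variable {X Y}

/-- The elementary tensor `x ⊗ y` in `X ⊗_π Y`. -/
def ProjTensor.tmul (x : X) (y : Y) : ProjTensor X Y :=
  UniformSpace.Completion.coe' (ProjAlg.tmul x y)

variable {V : Type*} [NormedAddCommGroup V] [NormedSpace ℝ V]

/-- The linear map on `X ⊗ Y` with `x ⊗ y ↦ B (x, y)`. -/
def ProjAlg.liftAux (B : X →L[ℝ] Y →L[ℝ] V) : ProjAlg X Y →ₗ[ℝ] V :=
  TensorProduct.lift (LinearMap.mk₂ ℝ (fun x y => B x y) (by simp) (by simp) (by simp) (by simp))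

@[simp]
theorem ProjAlg.liftAux_tmul (B : X →L[ℝ] Y →L[ℝ] V) (x : X) (y : Y) :
    ProjAlg.liftAux B (ProjAlg.tmul x y) = B x y :=
  TensorProduct.lift.tmul _ _

theorem ProjAlg.norm_liftAux_le (B : X →L[ℝ] Y →L[ℝ] V) (u : ProjAlg X Y) :
    ‖ProjAlg.liftAux B u‖ ≤ ‖B‖ * ‖u‖ := by
  have key : ∀ r ∈ u.costs, ‖ProjAlg.liftAux B u‖ ≤ ‖B‖ * r := by
    rintro r ⟨l, rfl, rfl⟩
    induction l with
    | nil => simp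
    | cons p l ih =>
      simp only [List.map_cons, List.sum_cons, map_add, ProjAlg.liftAux_tmul, mul_add]
      refine (norm_add_le _ _).trans (add_le_add ?_ ih)
      rw [← mul_assoc]
      exact B.le_opNorm₂ _ _
  refine le_of_forall_pos_le_add fun ε hε => ?_
  have hpos : 0 < ‖B‖ + 1 := by positivity
  obtain ⟨r, hr, hr'⟩ := Real.lt_sInf_add_pos u.costs_nonempty (div_pos hε hpos)
  rw [ProjAlg.norm_def]
  have h3 : ‖B‖ * r ≤ ‖B‖ * (sInf u.costs + ε / (‖B‖ + 1)) := by gcongr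
  have h4 : ‖B‖ * (ε / (‖B‖ + 1)) ≤ ε := by
    rw [← mul_div_assoc, div_le_iff₀ hpos]
    nlinarith [norm_nonneg B]
  linarith [key r hr]

/-- The lifting `B̂ : X ⊗_π Y → V` of a bounded bilinear map `B`, with `B̂ (x ⊗ y) = B (x, y)`. -/
def projLift [CompleteSpace V] (B : X →L[ℝ] Y →L[ℝ] V) : ProjTensor X Y →L[ℝ] V :=
  ((ProjAlg.liftAux B).mkContinuous ‖B‖ (ProjAlg.norm_liftAux_le B)).extend
    (UniformSpace.Completion.toComplL (𝕜 := ℝ) (E := ProjAlg X Y))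

theorem projLift_tmul [CompleteSpace V] (B : X →L[ℝ] Y →L[ℝ] V) (x : X) (y : Y) :
    projLift B (ProjTensor.tmul x y) = B x y :=
  (ContinuousLinearMap.extend_eq _ UniformSpace.Completion.denseRange_coe
    (UniformSpace.Completion.isUniformInducing_coe _) (ProjAlg.tmul x y)).trans
    (ProjAlg.liftAux_tmul B x y)

theorem ProjAlg.norm_tmul_le (x : X) (y : Y) : ‖ProjAlg.tmul x y‖ ≤ ‖x‖ * ‖y‖ :=
  csInf_le (ProjAlg.costs_bddBelow _) ⟨[(x, y)], by simp, by simp⟩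

theorem ProjAlg.induction {P : ProjAlg X Y → Prop} (u : ProjAlg X Y) (zero : P 0)
    (tmul : ∀ x y, P (ProjAlg.tmul x y)) (add : ∀ u v, P u → P v → P (u + v)) : P u :=
  TensorProduct.induction_on (motive := P) u zero tmul add

theorem ProjAlg.add_tmul (x x' : X) (y : Y) :
    ProjAlg.tmul (x + x') y = ProjAlg.tmul x y + ProjAlg.tmul x' y := TensorProduct.add_tmul x x' y

theorem ProjAlg.tmul_add (x : X) (y y' : Y) :
    ProjAlg.tmul x (y + y') = ProjAlg.tmul x y + ProjAlg.tmul x y' := TensorProduct.tmul_add x y y'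

theorem ProjAlg.smul_tmul (c : ℝ) (x : X) (y : Y) :
    ProjAlg.tmul (c • x) y = c • ProjAlg.tmul x y := (TensorProduct.smul_tmul' c x y).symm

theorem ProjAlg.tmul_smul (c : ℝ) (x : X) (y : Y) :
    ProjAlg.tmul x (c • y) = c • ProjAlg.tmul x y := TensorProduct.tmul_smul c x y

/-- The bounded bilinear map `(x, y) ↦ x ⊗ y` into `X ⊗_π Y`. -/
def projMk (X Y : Type*) [NormedAddCommGroup X] [NormedSpace ℝ X]
    [NormedAddCommGroup Y] [NormedSpace ℝ Y] : X →L[ℝ] Y →L[ℝ] ProjTensor X Y :=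
  LinearMap.mkContinuous₂
    (LinearMap.mk₂ ℝ (fun x y => ProjTensor.tmul x y)
      (fun x x' y => by
        simp only [ProjTensor.tmul, ProjAlg.add_tmul, UniformSpace.Completion.coe_add])
      (fun c x y => by
        simp only [ProjTensor.tmul, ProjAlg.smul_tmul, UniformSpace.Completion.coe_smul])
      (fun x y y' => by
        simp only [ProjTensor.tmul, ProjAlg.tmul_add, UniformSpace.Completion.coe_add])
      (fun c x y => by
        simp only [ProjTensor.tmul, ProjAlg.tmul_smul, UniformSpace.Completion.coe_smul]))
    1 (fun x y => by
      rw [one_mul]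
      exact (UniformSpace.Completion.norm_coe _).trans_le (ProjAlg.norm_tmul_le x y))

theorem projMk_apply (x : X) (y : Y) : projMk X Y x y = ProjTensor.tmul x y := rfl

variable {W : Type*} [NormedAddCommGroup W] [NormedSpace ℝ W]

/-- The operator `S ⊗_π T : X ⊗_π Y → W ⊗_π V` with `x ⊗ y ↦ S x ⊗ T y`. -/
def projMap (S : X →L[ℝ] W) (T : Y →L[ℝ] V) : ProjTensor X Y →L[ℝ] ProjTensor W V :=
  projLift ((projMk W V).bilinearComp S T)

theorem projMap_tmul (S : X →L[ℝ] W) (T : Y →L[ℝ] V) (x : X) (y : Y) :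
    projMap S T (ProjTensor.tmul x y) = ProjTensor.tmul (S x) (T y) :=
  projLift_tmul _ x y

/-- A bounded operator on `X ⊗_π Y` is determined by its values on elementary tensors. -/
theorem ProjTensor.clm_ext {F G : ProjTensor X Y →L[ℝ] V}
    (h : ∀ x y, F (ProjTensor.tmul x y) = G (ProjTensor.tmul x y)) : F = G := by
  ext u
  refine UniformSpace.Completion.induction_on u (isClosed_eq F.continuous G.continuous) ?_
  intro a
  induction a using ProjAlg.induction with
  | zero => simp only [UniformSpace.Completion.coe_zero, map_zero]
  | tmul x y => exact h x y
  | add a b ha hb => simp only [UniformSpace.Completion.coe_add, map_add, ha, hb]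

end Projective

/-! ## The injective tensor product of two normed spaces -/

section Injective

/-- The algebraic tensor product `X ⊗ Y`, as a type synonym that carries the injective norm. -/
def InjAlg (X Y : Type*) [NormedAddCommGroup X] [NormedSpace ℝ X]
    [NormedAddCommGroup Y] [NormedSpace ℝ Y] : Type _ := X ⊗[ℝ] Y

variable (X Y : Type*) [NormedAddCommGroup X] [NormedSpace ℝ X]
  [NormedAddCommGroup Y] [NormedSpace ℝ Y]

instance : AddCommGroup (InjAlg X Y) := inferInstanceAs (AddCommGroup (X ⊗[ℝ] Y))
instance : Module ℝ (InjAlg X Y) := inferInstanceAs (Module ℝ (X ⊗[ℝ] Y))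

variable {X Y}

/-- The elementary tensor `x ⊗ y`. -/
def InjAlg.tmul (x : X) (y : Y) : InjAlg X Y := x ⊗ₜ[ℝ] y

/-- The bounded bilinear form `(φ, ψ) ↦ φ x * ψ y` on `X* × Y*`. -/
def InjAlg.formTmul (x : X) (y : Y) : StrongDual ℝ X →L[ℝ] StrongDual ℝ Y →L[ℝ] ℝ :=
  (NormedSpace.inclusionInDoubleDual ℝ X x).smulRight (NormedSpace.inclusionInDoubleDual ℝ Y y)

theorem InjAlg.formTmul_apply (x : X) (y : Y) (φ : StrongDual ℝ X) (ψ : StrongDual ℝ Y) :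
    InjAlg.formTmul x y φ ψ = φ x * ψ y := rfl

variable (X Y)

/-- The linear map `u = ∑ xᵢ ⊗ yᵢ ↦ B_u`, where `B_u (φ, ψ) = ∑ φ xᵢ * ψ yᵢ`. -/
def InjAlg.form : InjAlg X Y →ₗ[ℝ] (StrongDual ℝ X →L[ℝ] StrongDual ℝ Y →L[ℝ] ℝ) :=
  TensorProduct.lift (LinearMap.mk₂ ℝ InjAlg.formTmul
    (fun _ _ _ => by ext; simp [InjAlg.formTmul_apply, add_mul])
    (fun _ _ _ => by ext; simp [InjAlg.formTmul_apply, mul_assoc])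
    (fun _ _ _ => by ext; simp [InjAlg.formTmul_apply, mul_add])
    (fun _ _ _ => by ext; simp [InjAlg.formTmul_apply, mul_left_comm]))

/-- The injective norm
`‖u‖_i = ‖B_u‖ = sup {|B_u (φ, ψ)| | ‖φ‖ ≤ 1, ‖ψ‖ ≤ 1}`. -/
instance : SeminormedAddCommGroup (InjAlg X Y) :=
  SeminormedAddCommGroup.induced _ _ (InjAlg.form X Y)

instance : NormedSpace ℝ (InjAlg X Y) := NormedSpace.induced ℝ _ _ (InjAlg.form X Y)

theorem InjAlg.norm_def (u : InjAlg X Y) : ‖u‖ = ‖InjAlg.form X Y u‖ := rfl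

/-- The injective tensor product `X ⊗_i Y`: the completion of `X ⊗ Y` in the injective norm. -/
abbrev InjTensor : Type _ := UniformSpace.Completion (InjAlg X Y)

variable {X Y}

/-- The elementary tensor `x ⊗ y` in `X ⊗_i Y`. -/
def InjTensor.tmul (x : X) (y : Y) : InjTensor X Y :=
  UniformSpace.Completion.coe' (InjAlg.tmul x y)

variable (X Y)

/-- The isometry `u ↦ B_u`, extended to `X ⊗_i Y`. -/
def InjTensor.form : InjTensor X Y →L[ℝ] (StrongDual ℝ X →L[ℝ] StrongDual ℝ Y →L[ℝ] ℝ) :=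
  (LinearIsometry.mk (InjAlg.form X Y) (fun _ => rfl)).toContinuousLinearMap.extend
    (UniformSpace.Completion.toComplL (𝕜 := ℝ) (E := InjAlg X Y))

variable {X Y}

theorem InjTensor.form_tmul (x : X) (y : Y) (φ : StrongDual ℝ X) (ψ : StrongDual ℝ Y) :
    InjTensor.form X Y (InjTensor.tmul x y) φ ψ = φ x * ψ y := by
  have h : InjTensor.form X Y (InjTensor.tmul x y) = InjAlg.formTmul x y :=
    (ContinuousLinearMap.extend_eq _ UniformSpace.Completion.denseRange_coe
      (UniformSpace.Completion.isUniformInducing_coe _) (InjAlg.tmul x y)).trans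
      (TensorProduct.lift.tmul _ _)
  rw [h, InjAlg.formTmul_apply]

variable (X Y)

/-- The bounded bilinear map `(φ, ψ) ↦ φ ⊗ ψ ∈ (X ⊗_i Y)*`, where `(φ ⊗ ψ) u = B_u (φ, ψ)`. -/
def InjTensor.dualTmul :
    StrongDual ℝ X →L[ℝ] StrongDual ℝ Y →L[ℝ] StrongDual ℝ (InjTensor X Y) :=
  ((ContinuousLinearMap.flipₗᵢ ℝ (InjTensor X Y) (StrongDual ℝ Y) ℝ :
      (InjTensor X Y →L[ℝ] StrongDual ℝ Y →L[ℝ] ℝ) →L[ℝ] _)).comp (InjTensor.form X Y).flip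

variable {X Y}

theorem InjTensor.dualTmul_apply (φ : StrongDual ℝ X) (ψ : StrongDual ℝ Y) (u : InjTensor X Y) :
    InjTensor.dualTmul X Y φ ψ u = InjTensor.form X Y u φ ψ := rfl

end Injective

/-! ## Duality of the two tensor products and weak* topologies -/

section Duality

variable {X Y X' Y' : Type*} [NormedAddCommGroup X] [NormedSpace ℝ X]
  [NormedAddCommGroup Y] [NormedSpace ℝ Y] [NormedAddCommGroup X'] [NormedSpace ℝ X']
  [NormedAddCommGroup Y'] [NormedSpace ℝ Y']

/-- Let `X'` and `Y'` act as dual spaces of `X` and `Y` through `a : X' → X*` and `b : Y' → Y*`.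
This is the induced map `X' ⊗_π Y' → (X ⊗_i Y)*`, the bounded linear map for which
`⟨x' ⊗ y', x ⊗ y⟩ = ⟨x', x⟩ ⟨y', y⟩`. -/
def tensorDuality (a : X' →L[ℝ] StrongDual ℝ X) (b : Y' →L[ℝ] StrongDual ℝ Y) :
    ProjTensor X' Y' →L[ℝ] StrongDual ℝ (InjTensor X Y) :=
  projLift ((InjTensor.dualTmul X Y).bilinearComp a b)

theorem tensorDuality_tmul (a : X' →L[ℝ] StrongDual ℝ X) (b : Y' →L[ℝ] StrongDual ℝ Y)
    (x' : X') (y' : Y') (x : X) (y : Y) :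
    tensorDuality a b (ProjTensor.tmul x' y') (InjTensor.tmul x y) = a x' x * b y' y := by
  rw [tensorDuality, projLift_tmul, ContinuousLinearMap.bilinearComp_apply,
    InjTensor.dualTmul_apply, InjTensor.form_tmul]

/-- The weak* topology on `X' ⊗_π Y'` with respect to the predual `X ⊗_i Y`: the pullback of the
weak* topology of `(X ⊗_i Y)*`, i.e. the coarsest topology for which `u ↦ ⟨u, w⟩` is continuous
for every `w ∈ X ⊗_i Y`. -/
@[reducible]
def weakStarTopology (a : X' →L[ℝ] StrongDual ℝ X) (b : Y' →L[ℝ] StrongDual ℝ Y) :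
    TopologicalSpace (ProjTensor X' Y') :=
  TopologicalSpace.induced (fun u => StrongDual.toWeakDual (tensorDuality a b u)) inferInstance

/-- A net converges weakly* in `X' ⊗_π Y'` iff all its pairings with `X ⊗_i Y` converge. -/
theorem tendsto_weakStarTopology_iff (a : X' →L[ℝ] StrongDual ℝ X)
    (b : Y' →L[ℝ] StrongDual ℝ Y) {ι : Type*} {l : Filter ι} (f : ι → ProjTensor X' Y')
    (u : ProjTensor X' Y') :
    Filter.Tendsto f l (@nhds _ (weakStarTopology a b) u) ↔
      ∀ w : InjTensor X Y,
        Filter.Tendsto (fun i => tensorDuality a b (f i) w) l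
          (nhds (tensorDuality a b u w)) := by
  rw [weakStarTopology, nhds_induced, Filter.tendsto_comap_iff]
  exact WeakBilin.tendsto_iff_forall_eval_tendsto (topDualPairing ℝ (InjTensor X Y))
    ContinuousLinearMap.coe_injective

end Duality

/-! ## The concrete spaces -/

/-- The extension `Ω_Σ = {x | ∃ y ∈ Σ, x - y ∈ Ω}` of `Ω` by `S = Σ`. -/
def extendedDomain {d : ℕ} (Ω S : Set (EuclideanSpace ℝ (Fin d))) :
    Set (EuclideanSpace ℝ (Fin d)) :=
  {x | ∃ y ∈ S, x - y ∈ Ω}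

/-- `C₀(A)`: real continuous functions on `A` that vanish at infinity, with the sup norm. -/
abbrev C0Space {d : ℕ} (A : Set (EuclideanSpace ℝ (Fin d))) : Type :=
  ZeroAtInftyContinuousMap A ℝ

/-- The Radon measures `M(A)`, as the dual of `C₀(A)`. -/
abbrev RadonSpace {d : ℕ} (A : Set (EuclideanSpace ℝ (Fin d))) : Type :=
  StrongDual ℝ (C0Space A)

/-- `L^s(S)` with respect to Lebesgue measure. -/
abbrev LebesgueSpace {d : ℕ} (S : Set (EuclideanSpace ℝ (Fin d))) (s : ℝ≥0∞) : Type :=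
  Lp ℝ s (volume.restrict S)

/-- The pairing `(p, g) ↦ ∫_S p g` of `L^s(S)` and `L^s'(S)`. -/
def lebesgueDuality {d : ℕ} (S : Set (EuclideanSpace ℝ (Fin d))) (s s' : ℝ≥0∞)
    [Fact (1 ≤ s)] [Fact (1 ≤ s')] [s.HolderConjugate s'] :
    LebesgueSpace S s →L[ℝ] StrongDual ℝ (LebesgueSpace S s') :=
  (ContinuousLinearMap.mul ℝ ℝ).lpPairing (volume.restrict S) s s'

theorem lebesgueDuality_apply {d : ℕ} (S : Set (EuclideanSpace ℝ (Fin d))) (s s' : ℝ≥0∞)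
    [Fact (1 ≤ s)] [Fact (1 ≤ s')] [s.HolderConjugate s']
    (p : LebesgueSpace S s) (g : LebesgueSpace S s') :
    lebesgueDuality S s s' p g = ∫ x in S, p x * g x :=
  ContinuousLinearMap.lpPairing_eq_integral _ p g

/-- The weak* topology of `M(A) ⊗_π L^s(S)`, with predual `C₀(A) ⊗_i L^s'(S)`. -/
@[reducible]
def weakStarRadonLebesgue {d : ℕ} (A S : Set (EuclideanSpace ℝ (Fin d))) (s s' : ℝ≥0∞)
    [Fact (1 ≤ s)] [Fact (1 ≤ s')] [s.HolderConjugate s'] :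
    TopologicalSpace (ProjTensor (RadonSpace A) (LebesgueSpace S s)) :=
  weakStarTopology (X := C0Space A) (Y := LebesgueSpace S s')
    (ContinuousLinearMap.id ℝ (RadonSpace A)) (lebesgueDuality S s s')

/-- The weak* topology of `M(A) ⊗_π Z`, with predual `C₀(A) ⊗_i Z*`, for `Z` reflexive
(so that `Z` is the dual of `Z*`). -/
@[reducible]
def weakStarRadonReflexive {d : ℕ} (A : Set (EuclideanSpace ℝ (Fin d)))
    (Z : Type*) [NormedAddCommGroup Z] [NormedSpace ℝ Z] :
    TopologicalSpace (ProjTensor (RadonSpace A) Z) :=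
  weakStarTopology (X := C0Space A) (Y := StrongDual ℝ Z)
    (ContinuousLinearMap.id ℝ (RadonSpace A)) (NormedSpace.inclusionInDoubleDual ℝ Z)

/-- `Z` is reflexive: the canonical isometric embedding of `Z` into `Z**` is onto. -/
def IsReflexiveSpace (Z : Type*) [NormedAddCommGroup Z] [NormedSpace ℝ Z] : Prop :=
  Function.Surjective (NormedSpace.inclusionInDoubleDual ℝ Z)

end

/-! ## Functoriality of the injective tensor product -/

section InjectiveMap

variable {X Y V : Type*} [NormedAddCommGroup X] [NormedSpace ℝ X]
  [NormedAddCommGroup Y] [NormedSpace ℝ Y] [NormedAddCommGroup V] [NormedSpace ℝ V]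

/-! An operator between dual spaces is weak* continuous as soon as it is the adjoint of a bounded
operator between the preduals. The preadjoint of `I ⊗_π M` is `I ⊗_i T`, where `T : Z* → L^s'` sends
`ψ` to the function representing the functional `ψ ∘ M` on `L^s`. The operator `I ⊗_i T` is bounded
because testing `(I ⊗ T) u` against `φ ⊗ ψ` amounts to testing `u` against `φ ⊗ (ψ ∘ T)`. The
adjoint identity `⟨(I ⊗_π M) u, w⟩ = ⟨u, (I ⊗_i T) w⟩` need only be checked on elementary tensors,
whose span is dense on both sides (`tensorDuality_projMap`).

The analytic input is the Riesz isomorphism of `L^s'` with `(L^s)*` (`lpDualEquiv`). A functional on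
`L^p` defines a signed measure, whose Radon–Nikodym density is shown to lie in `L^q` by bounding its
truncations with the extremal function of Hölder's inequality. It applies because the bounded set
`S` has finite measure and `1 < s < ∞`. -/

theorem InjAlg.induction {P : InjAlg X Y → Prop} (u : InjAlg X Y) (zero : P 0)
    (tmul : ∀ x y, P (InjAlg.tmul x y)) (add : ∀ u v, P u → P v → P (u + v)) : P u :=
  TensorProduct.induction_on (motive := P) u zero tmul add

theorem InjAlg.form_tmul (x : X) (y : Y) : InjAlg.form X Y (InjAlg.tmul x y) = formTmul x y :=
  TensorProduct.lift.tmul _ _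

/-- The linear map `I ⊗ T : X ⊗ V → X ⊗ Y`. -/
def InjAlg.map (X : Type*) [NormedAddCommGroup X] [NormedSpace ℝ X] (T : V →L[ℝ] Y) :
    InjAlg X V →ₗ[ℝ] InjAlg X Y :=
  LinearMap.lTensor X (T : V →ₗ[ℝ] Y)

theorem InjAlg.map_tmul (T : V →L[ℝ] Y) (x : X) (v : V) :
    InjAlg.map X T (InjAlg.tmul x v) = InjAlg.tmul x (T v) :=
  LinearMap.lTensor_tmul _ _ _ _

/-- Moves `T` from the tensor to the test functional; since `‖ψ ∘ T‖ ≤ ‖ψ‖ ‖T‖`, this gives the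
bound on the injective norm. -/
theorem InjAlg.form_map (T : V →L[ℝ] Y) (u : InjAlg X V) (φ : StrongDual ℝ X)
    (ψ : StrongDual ℝ Y) :
    InjAlg.form X Y (InjAlg.map X T u) φ ψ = InjAlg.form X V u φ (ψ.comp T) := by
  induction u using InjAlg.induction with
  | zero => simp
  | tmul x v => simp [InjAlg.map_tmul, InjAlg.form_tmul, InjAlg.formTmul_apply]
  | add u v hu hv => simp [hu, hv]

theorem InjAlg.norm_map_le (T : V →L[ℝ] Y) (u : InjAlg X V) :
    ‖InjAlg.map X T u‖ ≤ ‖T‖ * ‖u‖ := by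
  rw [InjAlg.norm_def, InjAlg.norm_def]
  refine ContinuousLinearMap.opNorm_le_bound₂ _ (by positivity) fun φ ψ => ?_
  rw [InjAlg.form_map]
  calc ‖InjAlg.form X V u φ (ψ.comp T)‖
      ≤ ‖InjAlg.form X V u‖ * ‖φ‖ * ‖ψ.comp T‖ := ContinuousLinearMap.le_opNorm₂ _ _ _
    _ ≤ ‖InjAlg.form X V u‖ * ‖φ‖ * (‖ψ‖ * ‖T‖) := by
        gcongr
        exact ψ.opNorm_comp_le T
    _ = ‖T‖ * ‖InjAlg.form X V u‖ * ‖φ‖ * ‖ψ‖ := by ring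

/-- The operator `I ⊗_i T : X ⊗_i V → X ⊗_i Y` with `x ⊗ v ↦ x ⊗ T v`. -/
noncomputable def injMap (X : Type*) [NormedAddCommGroup X] [NormedSpace ℝ X] (T : V →L[ℝ] Y) :
    InjTensor X V →L[ℝ] InjTensor X Y :=
  ((UniformSpace.Completion.toComplL (𝕜 := ℝ) (E := InjAlg X Y)).comp
    ((InjAlg.map X T).mkContinuous ‖T‖ (InjAlg.norm_map_le T))).extend
    (UniformSpace.Completion.toComplL (𝕜 := ℝ) (E := InjAlg X V))

theorem injMap_tmul (T : V →L[ℝ] Y) (x : X) (v : V) :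
    injMap X T (InjTensor.tmul x v) = InjTensor.tmul x (T v) := by
  refine (ContinuousLinearMap.extend_eq _ UniformSpace.Completion.denseRange_coe
    (UniformSpace.Completion.isUniformInducing_coe _) (InjAlg.tmul x v)).trans ?_
  exact congrArg UniformSpace.Completion.coe' (InjAlg.map_tmul T x v)

/-- A bounded operator on `X ⊗_i Y` is determined by its values on elementary tensors. -/
theorem InjTensor.clm_ext {F G : InjTensor X Y →L[ℝ] V}
    (h : ∀ x y, F (InjTensor.tmul x y) = G (InjTensor.tmul x y)) : F = G := by
  ext u
  refine UniformSpace.Completion.induction_on u (isClosed_eq F.continuous G.continuous) ?_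
  intro a
  induction a using InjAlg.induction with
  | zero => simp only [UniformSpace.Completion.coe_zero, map_zero]
  | tmul x y => exact h x y
  | add a b ha hb => simp only [UniformSpace.Completion.coe_add, map_add, ha, hb]

end InjectiveMap

/-! ## Weak* continuity of operators with a preadjoint -/

section Preadjoint

variable {X Y V X' Y' V' : Type*} [NormedAddCommGroup X] [NormedSpace ℝ X]
  [NormedAddCommGroup Y] [NormedSpace ℝ Y] [NormedAddCommGroup V] [NormedSpace ℝ V]
  [NormedAddCommGroup X'] [NormedSpace ℝ X'] [NormedAddCommGroup Y'] [NormedSpace ℝ Y']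
  [NormedAddCommGroup V'] [NormedSpace ℝ V']

/-- If `T` is a preadjoint of `M`, then `I ⊗_i T` is a preadjoint of `I ⊗_π M`. -/
theorem tensorDuality_projMap (a : X' →L[ℝ] StrongDual ℝ X) (b : Y' →L[ℝ] StrongDual ℝ Y)
    (c : V' →L[ℝ] StrongDual ℝ V) (M : Y' →L[ℝ] V') (T : V →L[ℝ] Y)
    (h : ∀ y' v, c (M y') v = b y' (T v)) (u : ProjTensor X' Y') (w : InjTensor X V) :
    tensorDuality a c (projMap (ContinuousLinearMap.id ℝ X') M u) w =
      tensorDuality a b u (injMap X T w) := by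
  -- Stated between bounded operators into the dual of `X ⊗_i V`, so that density of the elementary
  -- tensors can be used first in `u` and then in `w`.
  have key : (tensorDuality a c).comp (projMap (ContinuousLinearMap.id ℝ X') M) =
      ((injMap X T).precomp ℝ).comp (tensorDuality a b) := by
    refine ProjTensor.clm_ext fun x' y' => InjTensor.clm_ext fun x v => ?_
    change tensorDuality a c (projMap _ M (ProjTensor.tmul x' y')) (InjTensor.tmul x v) =
      tensorDuality a b (ProjTensor.tmul x' y') (injMap X T (InjTensor.tmul x v))
    rw [projMap_tmul, injMap_tmul, tensorDuality_tmul, tensorDuality_tmul, h]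
    rfl
  exact DFunLike.congr_fun (DFunLike.congr_fun key u) w

/-- Composing the operator with the pairing against `w` gives the pairing against `injMap X T w`,
which is one of the functionals defining the source topology. -/
theorem continuous_projMap_weakStar (a : X' →L[ℝ] StrongDual ℝ X) (b : Y' →L[ℝ] StrongDual ℝ Y)
    (c : V' →L[ℝ] StrongDual ℝ V) (M : Y' →L[ℝ] V') (T : V →L[ℝ] Y)
    (h : ∀ y' v, c (M y') v = b y' (T v)) :
    Continuous[weakStarTopology a b, weakStarTopology a c]
      (projMap (ContinuousLinearMap.id ℝ X') M) := by
  -- The topologies are passed explicitly, since the instance on the completions is the norm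
  -- topology.
  refine (@continuous_iff_continuousAt _ _ (weakStarTopology a b) (weakStarTopology a c) _).2
    fun u => ?_
  refine (tendsto_weakStarTopology_iff a c _ _).2 fun w => ?_
  simp only [tensorDuality_projMap a b c M T h]
  exact (tendsto_weakStarTopology_iff a b id u).1 (@Filter.tendsto_id _ _) (injMap X T w)

end Preadjoint

/-! ## The dual of `L^p` of a finite measure -/

section LpDual

variable {α : Type*} [MeasurableSpace α] {μ : Measure α} {p q : ℝ≥0∞}
  [Fact (1 ≤ p)] [Fact (1 ≤ q)] [p.HolderConjugate q]

/-- The extremal function `sign g * |g| ^ (q - 1)` in Hölder's inequality. -/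
theorem exists_lpPairing_eq_norm_rpow (hp : p ≠ ∞) (hq : q ≠ ∞) (g : Lp ℝ q μ) :
    ∃ f : Lp ℝ p μ, ‖f‖ ≤ ‖g‖ ^ (q.toReal - 1) ∧
      (ContinuousLinearMap.mul ℝ ℝ).lpPairing μ p q f g = ‖g‖ ^ q.toReal := by
  have hpq : p.toReal.HolderConjugate q.toReal := ENNReal.HolderConjugate.toReal_of_ne_top hp hq
  have hq0 : q ≠ 0 := (zero_lt_one.trans_le (Fact.out : 1 ≤ q)).ne'
  have hq1 : 0 < q.toReal - 1 := hpq.symm.sub_one_pos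
  -- Conjugacy in the form `p (q - 1) = q`: it places `|g| ^ (q - 1)` in `L^p` with norm `‖g‖ ^ (q -
  -- 1)`.
  have hmul : p * ENNReal.ofReal (q.toReal - 1) = q := by
    rw [← ENNReal.ofReal_toReal hp, ← ENNReal.ofReal_mul ENNReal.toReal_nonneg, mul_comm,
      hpq.symm.sub_one_mul_conj, ENNReal.ofReal_toReal hq]
  have hgm : Measurable (g : α → ℝ) := (Lp.stronglyMeasurable g).measurable
  set f : α → ℝ := fun x => Real.sign (g x) * ‖g x‖ ^ (q.toReal - 1) with hf
  have hfm : AEStronglyMeasurable f μ := by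
    have hsign : Measurable Real.sign := by
      unfold Real.sign
      exact Measurable.ite measurableSet_Iio measurable_const
        (Measurable.ite measurableSet_Ioi measurable_const measurable_const)
    exact ((hsign.comp hgm).mul (hgm.norm.pow_const _)).aestronglyMeasurable
  have hnorm : eLpNorm f p μ = eLpNorm g q μ ^ (q.toReal - 1) := by
    have h := eLpNorm_norm_rpow (p := p) (μ := μ) g hq1
    rw [hmul] at h
    rw [← h]
    refine eLpNorm_congr_norm_ae (Filter.Eventually.of_forall fun x => ?_)
    rcases lt_trichotomy (g x) 0 with h | h | h
    · simp [hf, Real.sign_of_neg h]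
    · simp [hf, h, Real.zero_rpow hq1.ne']
    · simp [hf, Real.sign_of_pos h]
  have hfL : MemLp f p μ :=
    ⟨hfm, hnorm ▸ ENNReal.rpow_lt_top_of_nonneg hq1.le (Lp.eLpNorm_ne_top g)⟩
  refine ⟨hfL.toLp f, ?_, ?_⟩
  · rw [Lp.norm_toLp, hnorm, ← ENNReal.toReal_rpow, Lp.norm_def]
  · rw [ContinuousLinearMap.lpPairing_eq_integral]
    have h1 : ∫ x, ContinuousLinearMap.mul ℝ ℝ (hfL.toLp f x) (g x) ∂μ
        = ∫ x, ‖g x‖ ^ q.toReal ∂μ := by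
      refine integral_congr_ae ?_
      filter_upwards [hfL.coeFn_toLp] with x hx
      have h2 : Real.sign (g x) * g x = ‖g x‖ := by
        rcases lt_trichotomy (g x) 0 with h | h | h
        · simp [Real.sign_of_neg h, abs_of_neg h]
        · simp [h]
        · simp [Real.sign_of_pos h, abs_of_pos h]
      rw [ContinuousLinearMap.mul_apply', hx, hf]
      simp only
      rw [mul_right_comm, h2, ← Real.rpow_one_add' (norm_nonneg _) (by linarith)]
      congr 1
      ring
    rw [h1, Lp.norm_def, (Lp.memLp g).eLpNorm_eq_integral_rpow_norm hq0 hq,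
      ENNReal.toReal_ofReal (by positivity),
      Real.rpow_inv_rpow (by positivity) (by linarith)]

/-- Test on the extremal function and cancel `‖g‖ ^ (q - 1)`. This yields both the injectivity of
`L^q → (L^p)*` and the `L^q` bound on truncated densities. -/
theorem norm_le_norm_lpPairing_flip (hp : p ≠ ∞) (hq : q ≠ ∞) (g : Lp ℝ q μ) :
    ‖g‖ ≤ ‖((ContinuousLinearMap.mul ℝ ℝ).lpPairing μ p q).flip g‖ := by
  obtain ⟨f, hf, hfg⟩ := exists_lpPairing_eq_norm_rpow (p := p) hp hq g
  rcases (norm_nonneg g).eq_or_lt with h0 | h0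
  · rw [← h0]
    positivity
  have h1 : ‖g‖ ^ (q.toReal - 1) * ‖g‖ ≤ ‖g‖ ^ (q.toReal - 1) *
      ‖((ContinuousLinearMap.mul ℝ ℝ).lpPairing μ p q).flip g‖ := by
    calc ‖g‖ ^ (q.toReal - 1) * ‖g‖ = ‖g‖ ^ q.toReal := by
          rw [Real.rpow_sub_one h0.ne', div_mul_cancel₀ _ h0.ne']
      _ = ((ContinuousLinearMap.mul ℝ ℝ).lpPairing μ p q).flip g f := hfg.symm
      _ ≤ ‖((ContinuousLinearMap.mul ℝ ℝ).lpPairing μ p q).flip g‖ * ‖f‖ :=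
          (le_abs_self _).trans
            ((((ContinuousLinearMap.mul ℝ ℝ).lpPairing μ p q).flip g).le_opNorm f)
      _ ≤ _ := by
          rw [mul_comm]
          gcongr
  exact le_of_mul_le_mul_left h1 (by positivity)

/-- Multiplication by an indicator function does not increase the norm. -/
theorem exists_indicator_clm (p : ℝ≥0∞) [Fact (1 ≤ p)] {E : Set α} (hE : MeasurableSet E) :
    ∃ P : Lp ℝ p μ →L[ℝ] Lp ℝ p μ, ‖P‖ ≤ 1 ∧ ∀ f, P f =ᵐ[μ] E.indicator f := by
  let P : Lp ℝ p μ →ₗ[ℝ] Lp ℝ p μ :=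
    { toFun f := ((Lp.memLp f).indicator hE).toLp _
      map_add' f g := by
        rw [← MemLp.toLp_add, MemLp.toLp_eq_toLp_iff, ← Set.indicator_add']
        filter_upwards [Lp.coeFn_add f g] with x hx
        by_cases h : x ∈ E
        · rw [Set.indicator_of_mem h, Set.indicator_of_mem h, hx]
        · rw [Set.indicator_of_notMem h, Set.indicator_of_notMem h]
      map_smul' c f := by
        rw [RingHom.id_apply, ← MemLp.toLp_const_smul, MemLp.toLp_eq_toLp_iff]
        filter_upwards [Lp.coeFn_smul c f] with x hx
        by_cases h : x ∈ E
        · simp only [Set.indicator_of_mem h, Pi.smul_apply, hx]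
        · simp only [Set.indicator_of_notMem h, Pi.smul_apply, smul_zero] }
  suffices hP : ∀ f, ‖P f‖ ≤ 1 * ‖f‖ from
    ⟨P.mkContinuous 1 hP, P.mkContinuous_norm_le zero_le_one _, fun f =>
    ((Lp.memLp f).indicator hE).coeFn_toLp⟩
  intro f
  rw [one_mul]
  refine Lp.norm_le_norm_of_ae_le ?_
  filter_upwards [((Lp.memLp f).indicator hE).coeFn_toLp] with x hx
  change ‖((Lp.memLp f).indicator hE).toLp _ x‖ ≤ _
  rw [hx]
  exact norm_indicator_le_norm_self _ _

/-! ### Riesz representation over a finite measure. -/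

variable [IsFiniteMeasure μ]

/-- Functionals on `L^p` that agree on indicator functions are equal. -/
theorem Lp.strongDual_ext (hp : p ≠ ∞) {φ ψ : StrongDual ℝ (Lp ℝ p μ)}
    (h : ∀ (s : Set α) (hs : MeasurableSet s),
      φ (indicatorConstLp p hs (measure_ne_top μ s) 1) =
        ψ (indicatorConstLp p hs (measure_ne_top μ s) 1)) : φ = ψ := by
  ext f
  refine Lp.induction hp (motive := fun f => φ f = ψ f) ?_ ?_
    (isClosed_eq φ.continuous ψ.continuous) f
  · intro c s hs hμs
    have : (Lp.simpleFunc.indicatorConst p hs hμs.ne c : Lp ℝ p μ) =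
        c • indicatorConstLp p hs (measure_ne_top μ s) 1 := by
      rw [Lp.simpleFunc.coe_indicatorConst]
      ext1
      filter_upwards [indicatorConstLp_coeFn (p := p) (hs := hs) (hμs := hμs.ne) (c := c),
        indicatorConstLp_coeFn (p := p) (hs := hs) (hμs := measure_ne_top μ s) (c := (1 : ℝ)),
        Lp.coeFn_smul c (indicatorConstLp p hs (measure_ne_top μ s) (1 : ℝ))] with x h1 h2 h3
      rw [h1, h3, Pi.smul_apply, h2]
      by_cases h : x ∈ s <;> simp [h]
    rw [this, map_smul, map_smul, h]
  · intro f g hf hg _ h1 h2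
    rw [map_add, map_add, h1, h2]

/-- The signed measure `s ↦ φ 1_s` of a functional `φ` on `L^p`. -/
noncomputable def lpFunctionalMeasure (hp : p ≠ ∞) (φ : StrongDual ℝ (Lp ℝ p μ)) : SignedMeasure α where
  measureOf' s := by
    classical
    exact if hs : MeasurableSet s then φ (indicatorConstLp p hs (measure_ne_top μ s) 1) else 0
  empty' := by simp
  not_measurable' s hs := by simp [hs]
  m_iUnion' A hA hd := by
    have hsum : HasSum (fun i => μ (A i)) (μ (⋃ i, A i)) := by
      rw [measure_iUnion hd hA]
      exact ENNReal.summable.hasSum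
    have hF : ∀ F : Finset ℕ, MeasurableSet (⋃ i ∈ F, A i) := fun F =>
      F.measurableSet_biUnion fun i _ => hA i
    -- Countable additivity: the finite unions approach the full union in measure, so for `p < ∞`
    -- their indicators converge in `L^p`, and `φ` is continuous. The limit runs over finsets
    -- because `HasSum` is unconditional.
    have hlim : Filter.Tendsto (fun F : Finset ℕ => μ (symmDiff (⋃ i ∈ F, A i) (⋃ i, A i)))
        Filter.atTop (𝓝 0) := by
      have h1 : ∀ F : Finset ℕ, μ (symmDiff (⋃ i ∈ F, A i) (⋃ i, A i)) =
          μ (⋃ i, A i) - ∑ i ∈ F, μ (A i) := by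
        intro F
        have hsub : (⋃ i ∈ F, A i) ⊆ ⋃ i, A i := Set.iUnion₂_subset fun i _ => Set.subset_iUnion A i
        rw [symmDiff_of_le hsub, measure_sdiff hsub (hF F).nullMeasurableSet (measure_ne_top _ _),
          measure_biUnion_finset (fun i _ j _ hij => hd hij) fun i _ => hA i]
      simp only [h1]
      have := ENNReal.Tendsto.sub (tendsto_const_nhds (x := μ (⋃ i, A i))) hsum
        (Or.inl (measure_ne_top _ _))
      simpa using this
    have hind := (φ.continuous.tendsto _).comp (tendsto_indicatorConstLp_set (p := p) (c := (1 : ℝ))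
      (hs := MeasurableSet.iUnion hA) (hμs := measure_ne_top μ _) (ht := hF)
      (hμt := fun _ => measure_ne_top μ _) hp hlim)
    have hfin : ∀ F : Finset ℕ, φ (indicatorConstLp p (hF F) (measure_ne_top μ _) 1) =
        ∑ i ∈ F, φ (indicatorConstLp p (hA i) (measure_ne_top μ _) 1) := by
      intro F
      induction F using Finset.induction_on with
      | empty => simp
      | insert i F hi ih =>
        rw [Finset.sum_insert hi, ← ih, ← map_add, ← indicatorConstLp_disjoint_union]
        · simp
        · exact Set.disjoint_iUnion₂_right.2 fun j hj => hd (ne_of_mem_of_not_mem hj hi).symm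
    simp only [hA, MeasurableSet.iUnion hA, dif_pos]
    refine hind.congr fun F => hfin F

theorem lpFunctionalMeasure_apply (hp : p ≠ ∞) (φ : StrongDual ℝ (Lp ℝ p μ)) {s : Set α}
    (hs : MeasurableSet s) :
    lpFunctionalMeasure hp φ s = φ (indicatorConstLp p hs (measure_ne_top μ s) 1) :=
  dif_pos hs

/-- The indicator of a null set is zero in `L^p`. This is what lets Radon–Nikodym recover the whole
measure from its density. -/
theorem lpFunctionalMeasure_absolutelyContinuous (hp : p ≠ ∞) (φ : StrongDual ℝ (Lp ℝ p μ)) :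
    lpFunctionalMeasure hp φ ≪ᵥ μ.toENNRealVectorMeasure := by
  refine VectorMeasure.AbsolutelyContinuous.mk fun s hs h0 => ?_
  rw [Measure.toENNRealVectorMeasure_apply_measurable hs] at h0
  rw [lpFunctionalMeasure_apply hp φ hs]
  have : indicatorConstLp p hs (measure_ne_top μ s) (1 : ℝ) = 0 := by
    rw [← norm_le_zero_iff]
    refine norm_indicatorConstLp_le.trans (le_of_eq ?_)
    have hp1 : 0 < p.toReal :=
      ENNReal.toReal_pos (zero_lt_one.trans_le (Fact.out : 1 ≤ p)).ne' hp
    rw [measureReal_def, h0, ENNReal.toReal_zero, Real.zero_rpow (one_div_pos.2 hp1).ne', mul_zero]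
  rw [this, map_zero]

theorem lpPairing_indicatorConstLp (g : Lp ℝ q μ) {s : Set α} (hs : MeasurableSet s) :
    (ContinuousLinearMap.mul ℝ ℝ).lpPairing μ p q
      (indicatorConstLp p hs (measure_ne_top μ s) 1) g = ∫ x in s, g x ∂μ := by
  rw [ContinuousLinearMap.lpPairing_eq_integral, ← integral_indicator hs]
  refine integral_congr_ae ?_
  filter_upwards [indicatorConstLp_coeFn (p := p) (hs := hs) (hμs := measure_ne_top μ s)
    (c := (1 : ℝ))] with x hx
  rw [hx]
  by_cases h : x ∈ s <;> simp [h]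

/-- **Riesz representation**: every bounded functional on `L^p` is `f ↦ ∫ f g` for some
`g ∈ L^q`. -/
theorem exists_lpPairing_flip_eq (hp : p ≠ ∞) (hq : q ≠ ∞) (φ : StrongDual ℝ (Lp ℝ p μ)) :
    ∃ g : Lp ℝ q μ, ((ContinuousLinearMap.mul ℝ ℝ).lpPairing μ p q).flip g = φ := by
  set g : α → ℝ := (lpFunctionalMeasure hp φ).rnDeriv μ with hg
  have hgm : Measurable g := SignedMeasure.measurable_rnDeriv _ _
  have hgi : Integrable g μ := SignedMeasure.integrable_rnDeriv _ _
  have hgφ : ∀ (s : Set α) (hs : MeasurableSet s),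
      φ (indicatorConstLp p hs (measure_ne_top μ s) 1) = ∫ x in s, g x ∂μ := by
    intro s hs
    rw [← withDensityᵥ_apply hgi hs, hg, SignedMeasure.withDensityᵥ_rnDeriv_eq _ _
      (lpFunctionalMeasure_absolutelyContinuous hp φ), lpFunctionalMeasure_apply hp φ hs]
  -- So far `g` is only integrable. Its truncations to `E n` are bounded, hence in `L^q` as `μ` is
  -- finite.
  let E : ℕ → Set α := fun n => {x | ‖g x‖ ≤ n}
  have hE : ∀ n, MeasurableSet (E n) := fun n => measurableSet_le hgm.norm measurable_const
  have hEL : ∀ n, MemLp ((E n).indicator g) q μ := fun n =>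
    MemLp.of_bound (hgm.indicator (hE n)).aestronglyMeasurable n
      (Filter.Eventually.of_forall fun x => by
        by_cases h : x ∈ E n
        · rw [Set.indicator_of_mem h]
          exact h
        · simp [Set.indicator_of_notMem h])
  have hbound : ∀ n, eLpNorm ((E n).indicator g) q μ ≤ ENNReal.ofReal ‖φ‖ := by
    intro n
    obtain ⟨P, hP1, hP⟩ := exists_indicator_clm (μ := μ) p (hE n)
    -- The truncated density represents `φ ∘ P`, where `P` is multiplication by the indicator of `E
    -- n`; as `‖P‖ ≤ 1`, the bound `‖φ‖` is uniform in `n`.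
    have heq : ((ContinuousLinearMap.mul ℝ ℝ).lpPairing μ p q).flip ((hEL n).toLp _) =
        φ.comp P := by
      refine Lp.strongDual_ext hp fun s hs => ?_
      have hPs : P (indicatorConstLp p hs (measure_ne_top μ s) 1) =
          indicatorConstLp p (hs.inter (hE n)) (measure_ne_top μ _) 1 := by
        ext1
        filter_upwards [hP (indicatorConstLp p hs (measure_ne_top μ s) 1),
          indicatorConstLp_coeFn (p := p) (hs := hs) (hμs := measure_ne_top μ s) (c := (1 : ℝ)),
          indicatorConstLp_coeFn (p := p) (hs := hs.inter (hE n)) (hμs := measure_ne_top μ _)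
            (c := (1 : ℝ))] with x h1 h2 h3
        rw [h1, h3, Set.inter_comm, ← Set.indicator_indicator]
        by_cases h : x ∈ E n
        · rw [Set.indicator_of_mem h, Set.indicator_of_mem h, h2]
        · rw [Set.indicator_of_notMem h, Set.indicator_of_notMem h]
      rw [ContinuousLinearMap.flip_apply, lpPairing_indicatorConstLp,
        ContinuousLinearMap.comp_apply, hPs, hgφ, ← setIntegral_indicator (hE n)]
      exact integral_congr_ae (ae_restrict_of_ae (hEL n).coeFn_toLp)
    have h1 : ‖(hEL n).toLp _‖ ≤ ‖φ‖ := by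
      refine (norm_le_norm_lpPairing_flip (p := p) hp hq _).trans ?_
      rw [heq]
      refine (φ.opNorm_comp_le P).trans ?_
      exact mul_le_of_le_one_right (norm_nonneg _) hP1
    rw [Lp.norm_toLp] at h1
    exact (ENNReal.le_ofReal_iff_toReal_le (hEL n).eLpNorm_ne_top (norm_nonneg _)).2 h1
  have hgL : MemLp g q μ := by
    refine ⟨hgm.aestronglyMeasurable, ?_⟩
    refine lt_of_le_of_lt (b := ENNReal.ofReal ‖φ‖) ?_ ENNReal.ofReal_lt_top
    -- Fatou: at each point the truncations eventually equal `g`.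
    refine (Lp.eLpNorm_lim_le_liminf_eLpNorm (fun n => (hEL n).aestronglyMeasurable) g
      (Filter.Eventually.of_forall fun x => ?_)).trans ?_
    · refine tendsto_const_nhds.congr' ?_
      obtain ⟨N, hN⟩ := exists_nat_ge ‖g x‖
      filter_upwards [Filter.eventually_ge_atTop N] with n hn
      exact (Set.indicator_of_mem (s := E n)
        (show ‖g x‖ ≤ n from hN.trans (by exact_mod_cast hn)) g).symm
    · refine (Filter.liminf_le_liminf (Filter.Eventually.of_forall hbound)).trans ?_
      simp
  refine ⟨hgL.toLp g, Lp.strongDual_ext hp fun s hs => ?_⟩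
  rw [ContinuousLinearMap.flip_apply, lpPairing_indicatorConstLp, hgφ]
  exact integral_congr_ae (ae_restrict_of_ae hgL.coeFn_toLp)

/-- The isomorphism of `L^q` with the dual of `L^p`. -/
noncomputable def lpDualEquiv (hp : p ≠ ∞) (hq : q ≠ ∞) : Lp ℝ q μ ≃L[ℝ] StrongDual ℝ (Lp ℝ p μ) :=
  -- The open mapping theorem makes the inverse bounded.
  ContinuousLinearEquiv.ofBijective ((ContinuousLinearMap.mul ℝ ℝ).lpPairing μ p q).flip
    (LinearMap.ker_eq_bot'.2 fun g hg => norm_le_zero_iff.1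
      ((norm_le_norm_lpPairing_flip (p := p) hp hq g).trans (norm_le_zero_iff.2 hg)))
    (LinearMap.range_eq_top.2 (exists_lpPairing_flip_eq hp hq))

theorem lpPairing_lpDualEquiv_symm (hp : p ≠ ∞) (hq : q ≠ ∞) (φ : StrongDual ℝ (Lp ℝ p μ))
    (f : Lp ℝ p μ) :
    (ContinuousLinearMap.mul ℝ ℝ).lpPairing μ p q f ((lpDualEquiv hp hq).symm φ) = φ f :=
  DFunLike.congr_fun ((lpDualEquiv hp hq).apply_symm_apply φ) f

end LpDual

/-! ### Weak* continuity of `I ⊗_π M`. -/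

theorem mainTheorem7 {d : ℕ} (Ω S : Set (EuclideanSpace ℝ (Fin d)))
    (hΩ : IsOpen Ω) (hΩb : Bornology.IsBounded Ω) (hS : IsOpen S) (hSb : Bornology.IsBounded S)
    (q s s' : ℝ≥0∞) (hq1 : 1 < q) (hq2 : q ≤ 2) (hqs : q ≤ s) (hs : s < ∞)
    [Fact (1 ≤ s)] [Fact (1 ≤ s')] [s.HolderConjugate s']
    {Z : Type*} [NormedAddCommGroup Z] [NormedSpace ℝ Z] [CompleteSpace Z]
    (hZ : IsReflexiveSpace Z) (M : LebesgueSpace S s →L[ℝ] Z) :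
    Continuous[weakStarRadonLebesgue (extendedDomain Ω S) S s s',
      weakStarRadonReflexive (extendedDomain Ω S) Z]
      (projMap (ContinuousLinearMap.id ℝ (RadonSpace (extendedDomain Ω S))) M) := by
  have : IsFiniteMeasure (volume.restrict S) := ⟨by
    rw [Measure.restrict_apply_univ]
    exact hSb.measure_lt_top⟩
  have hs' : s' ≠ ∞ :=
    ((ENNReal.HolderConjugate.lt_top_iff_one_lt s' s).2 (hq1.trans_le hqs)).ne
  -- The preadjoint `T`: restrict along `M`, `ψ ↦ ψ ∘ M`, then apply the inverse Riesz isomorphism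
  -- `(L^s)* → L^s'`.
  refine continuous_projMap_weakStar _ _ _ M
    ((lpDualEquiv (μ := volume.restrict S) hs.ne hs').symm.toContinuousLinearMap.comp
      (M.precomp ℝ)) fun p ψ => ?_
  exact (lpPairing_lpDualEquiv_symm hs.ne hs' (ψ.comp M) p).symm
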